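/- Fix a positive integer $k$. A $k$-graph is a small category $\Lambda$ with a degree functor $d:\Lambda\to\mathbb N^k$ such that whenever $d(\lambda)=m+n$ there are unique paths (morphisms) $\mu,\nu$ with $d(\mu)=m$, $d(\nu)=n$ and $\lambda=\mu\circ\nu$; write $\Lambda v$ and $v\Lambda$ for the sets of paths with source $v$ and with range $v$, and $v\Lambda^n$ for the paths of degree $n$ in $v\Lambda$. All $k$-graphs are assumed to be nonempty, connected (any two vertices are joined by a zigzag of paths), row-finite and without sources (each $v\Lambda^n$ is finite and nonempty). Morphisms of $k$-graphs are degree-preserving functors. A covering of a $k$-graph $\Delta$ is a pair $(\Omega,\tau)$ with $\tau:\Omega\to\Delta$ a morphism of $k$-graphs that maps $\Omega v$ bijectively onto $\Delta\tau(v)$ and $v\Omega$ bijectively onto $\tau(v)\Delta$ for every vertex $v$ of $\Omega$. It is universal if for every covering $(\Sigma,\beta)$ of $\Delta$ there is a morphism $\phi:\Omega\to\Sigma$ with $\beta\circ\phi=\tau$. Let $\Lambda$ be a $k$-graph. A representation $k$-graph for $\Lambda$ is a pair $(\Delta,\alpha)$ with $\Delta$ a $k$-graph and $\alpha:\Delta\to\Lambda$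 a morphism such that, for every vertex $v$ of $\Delta$, $\alpha$ maps $\Delta v$ bijectively onto $\Lambda\alpha(v)$, and $v\Delta^n$ is a singleton for every $n\in\mathbb N^k$. With the morphisms of $k$-graphs over $\Lambda$ these form a category $\mathbf{RG}(\Lambda)$. A walk in $\Delta$ is a nonempty finite sequence of consecutive edges, each of which is a path $\delta$ of $\Delta$ or the formal reverse $\delta^*$ of a non-identity path $\delta$; $\operatorname{Walk}_u(\Delta)$ is the set of walks starting in $u$. An equivalence relation $\approx$ on the vertices of $\Delta$ is admissible for $(\Delta,\alpha)$ if (i) $u\approx v$ implies $\alpha(\operatorname{Walk}_u(\Delta))=\alpha(\operatorname{Walk}_v(\Delta))$, and (ii) if $u\approx v$, $p$ is a walk from $u$ to $x$, $q$ is a walk from $v$ to $y$ and $\alpha(p)=\alpha(q)$, then $x\approx y$. The corresponding quotient $(\Delta_\approx,\alpha_\approx)$ is the representation $k$-graph for $\Lambda$ whose vertices are the classes $[v]$ of vertices and whose paths are the classes $[\delta]$ of paths, where $\delta\approx\delta'$ iff $s(\delta)\approx s(\delta')$ and $\alpha(\delta)=\alpha(\delta')$, with source, range, degree, identities, composition and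 $\alpha_\approx$ induced by those of $\Delta$ and by $\alpha$ (to compose classes, choose composable representatives). **Theorem.** Let $C$ be a connected component of $\mathbf{RG}(\Lambda)$ and let $(\Delta,\alpha)$ be any object of $C$. Then $\Delta$ has a universal covering. For every universal covering $(\Omega,\tau)$ of $\Delta$, put $(\Omega_C,\zeta_C):=(\Omega,\alpha\circ\tau)$. Then $(\Omega_C,\zeta_C)$ is an object of $C$ and is repelling in $C$: for every object $Y$ of $C$ there is a morphism $(\Omega_C,\zeta_C)\to Y$. Moreover, a representation $k$-graph for $\Lambda$ is an object of $C$ if and only if it is isomorphic to a quotient of $(\Omega_C,\zeta_C)$. -/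

import Mathlib

open CategoryTheory

universe u

namespace HigherRank

/-- A `k`-graph: a small category with a degree functor to the one-object category `ℕ^k` that has
the factorisation property. As a standing assumption every `k`-graph is nonempty and connected
(Mathlib's `IsConnected` includes nonemptiness), row-finite and without sources.

A path of degree `d(f)` from its source `x` to its range `y` is a morphism `f : x ⟶ y`; the
composite written `μ ∘ ν` classically is `ν ≫ μ`. `Quiver.Costar v` is the set of all paths with
range `v`, and `Quiver.Star v` is the set of all paths with source `v`. -/
structure KGraph (k : ℕ) where
  /-- the vertices -/
  Ob : Type u
  [cat : SmallCategory Ob]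
  /-- the degree map -/
  deg : ∀ {x y : Ob}, (x ⟶ y) → (Fin k → ℕ)
  deg_id : ∀ x : Ob, deg (𝟙 x) = 0
  deg_comp : ∀ {x y z : Ob} (f : x ⟶ y) (g : y ⟶ z), deg (f ≫ g) = deg g + deg f
  factorisation : ∀ {x y : Ob} (f : x ⟶ y) (m n : Fin k → ℕ), deg f = m + n →
    ∃! p : Σ z : Ob, (x ⟶ z) × (z ⟶ y),
      deg p.2.2 = m ∧ deg p.2.1 = n ∧ p.2.1 ≫ p.2.2 = f
  connected : IsConnected Ob
  rowFinite : ∀ (v : Ob) (n : Fin k → ℕ), {p : Quiver.Costar v | deg p.2 = n}.Finite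
  noSources : ∀ (v : Ob) (n : Fin k → ℕ), {p : Quiver.Costar v | deg p.2 = n}.Nonempty

attribute [instance] KGraph.cat KGraph.connected

variable {k : ℕ}

namespace KGraph

/-- A morphism of `k`-graphs: a degree-preserving functor. -/
structure Hom (Δ Λ : KGraph.{u} k) extends Δ.Ob ⥤ Λ.Ob where
  deg_map : ∀ {x y : Δ.Ob} (f : x ⟶ y), Λ.deg (map f) = Δ.deg f

instance : Category (KGraph.{u} k) where
  Hom := Hom
  id Λ := { toFunctor := 𝟭 Λ.Ob, deg_map := fun _ => rfl }
  comp φ ψ :=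
    { toFunctor := φ.toFunctor ⋙ ψ.toFunctor
      deg_map := fun f => (ψ.deg_map _).trans (φ.deg_map f) }

/-- The set of all paths (morphisms) of a `k`-graph, with arbitrary source `e.left` and
range `e.right`. -/
abbrev Path (Λ : KGraph.{u} k) : Type u := Quiver.Total Λ.Ob

/-- The path is an identity morphism. -/
def Path.IsIdentity {Λ : KGraph.{u} k} (e : Λ.Path) : Prop :=
  ∃ v : Λ.Ob, e = ⟨v, v, 𝟙 v⟩

/-- The map on paths induced by a morphism of `k`-graphs. -/
def Hom.onPath {Δ Λ : KGraph.{u} k} (φ : Δ ⟶ Λ) (e : Δ.Path) : Λ.Path :=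
  ⟨φ.obj e.left, φ.obj e.right, φ.map e.hom⟩

/-- A covering `τ : Ω ⟶ Λ`: for every vertex `v` of `Ω`, `τ` maps the paths with source `v`
one-to-one onto the paths with source `τ v`, and the paths with range `v` one-to-one onto the paths
with range `τ v`. -/
def IsCovering {Ω Λ : KGraph.{u} k} (τ : Ω ⟶ Λ) : Prop :=
  τ.toPrefunctor.IsCovering

/-- A covering is universal if it maps to every covering of the same `k`-graph. -/
structure IsUniversalCovering {Ω Λ : KGraph.{u} k} (τ : Ω ⟶ Λ) : Prop where
  isCovering : IsCovering τ
  exists_hom : ∀ (S : KGraph.{u} k) (β : S ⟶ Λ), IsCovering β → ∃ φ : Ω ⟶ S, φ ≫ β = τ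

/-! ### Walks -/

/-- The formal edges `e` and `e*`, for a path `e`. Here `e*` is `e` with reversed direction. -/
inductive Edge (Λ : KGraph.{u} k) : Type u
  | pos (e : Λ.Path) : Edge Λ
  | neg (e : Λ.Path) : Edge Λ

namespace Edge

variable {Λ : KGraph.{u} k}

def source : Edge Λ → Λ.Ob
  | pos e => e.left
  | neg e => e.right

def range : Edge Λ → Λ.Ob
  | pos e => e.right
  | neg e => e.left

/-- Reversed edges are only added for paths that are not identities. -/
def IsProper : Edge Λ → Prop
  | pos _ => True
  | neg e => ¬ Path.IsIdentity e

end Edge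

/-- The map `e ↦ φ e`, `e* ↦ (φ e)*`. -/
def Hom.onEdge {Δ Λ : KGraph.{u} k} (φ : Δ ⟶ Λ) : Edge Δ → Edge Λ
  | .pos e => .pos (Hom.onPath φ e)
  | .neg e => .neg (Hom.onPath φ e)

/-- The list of edges, in the order in which they are traversed, leads from `u` to `v`. -/
def IsChain {Λ : KGraph.{u} k} : Λ.Ob → List (Edge Λ) → Λ.Ob → Prop
  | u, [], v => u = v
  | u, e :: p, v => e.IsProper ∧ e.source = u ∧ IsChain e.range p v

/-- `p` is a walk from `u` to `v`: a nonempty finite sequence of consecutive edges. -/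
def IsWalk {Λ : KGraph.{u} k} (u : Λ.Ob) (p : List (Edge Λ)) (v : Λ.Ob) : Prop :=
  p ≠ [] ∧ IsChain u p v

/-- `φ(Walk_u(Δ))`: the images under `φ` of the walks in `Δ` starting in `u`. -/
def walkImage {Δ Λ : KGraph.{u} k} (φ : Δ ⟶ Λ) (u : Δ.Ob) : Set (List (Edge Λ)) :=
  {w | ∃ p v, IsWalk u p v ∧ p.map (Hom.onEdge φ) = w}

end KGraph

open KGraph

/-! ### Representation `k`-graphs -/

/-- A representation `k`-graph for `Λ`. -/
structure RepKGraph (Λ : KGraph.{u} k) where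
  graph : KGraph.{u} k
  map : graph ⟶ Λ
  /-- the paths with source `v` are mapped one-to-one onto the paths with source `map v` -/
  bijective_source : ∀ v : graph.Ob, Function.Bijective (map.toPrefunctor.star v)
  /-- for any degree there is exactly one path of that degree with range `v` -/
  existsUnique_range : ∀ (v : graph.Ob) (n : Fin k → ℕ),
    ∃! p : Quiver.Costar v, graph.deg p.2 = n

namespace RepKGraph

variable {Λ : KGraph.{u} k}

/-- A morphism of representation `k`-graphs: a morphism of `k`-graphs over `Λ`. -/
@[ext]
structure Hom (X Y : RepKGraph Λ) where
  hom : X.graph ⟶ Y.graph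
  comm : hom ≫ Y.map = X.map

/-- The category `RG(Λ)` of representation `k`-graphs for `Λ`. -/
instance : Category (RepKGraph Λ) where
  Hom := Hom
  id X := { hom := 𝟙 X.graph, comm := Category.id_comp _ }
  comp φ ψ := { hom := φ.hom ≫ ψ.hom, comm := by rw [Category.assoc, ψ.comm, φ.comm] }

/-- If `(Δ, α)` is a representation `k`-graph for `Λ` and `(Ω, τ)` is a covering of `Δ`, then
`(Ω, α ∘ τ)` is a representation `k`-graph for `Λ`. -/
def ofCovering (X : RepKGraph Λ) {Ω : KGraph.{u} k} (τ : Ω ⟶ X.graph) (hτ : IsCovering τ) :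
    RepKGraph Λ where
  graph := Ω
  map := τ ≫ X.map
  bijective_source v := (X.bijective_source (τ.obj v)).comp (hτ.star_bijective v)
  existsUnique_range v n := by
    obtain ⟨q, hq, hu⟩ := X.existsUnique_range (τ.obj v) n
    obtain ⟨p, rfl⟩ := (hτ.costar_bijective v).2 q
    refine ⟨p, (τ.deg_map p.2).symm.trans hq, fun p' hp' => (hτ.costar_bijective v).1 (hu _ ?_)⟩
    exact (τ.deg_map p'.2).trans hp'

/-! ### Quotients -/

/-- An equivalence relation `r` on the vertices of `(Δ, α)` is admissible if
(i) it is finer than the relation `α(Walk_u(Δ)) = α(Walk_v(Δ))`, and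
(ii) the ends of walks with the same image under `α` are equivalent whenever their starting
points are. -/
structure IsAdmissible (X : RepKGraph Λ) (r : Setoid X.graph.Ob) : Prop where
  walkImage_eq : ∀ u v, r u v → walkImage X.map u = walkImage X.map v
  range_rel : ∀ u v x y p q, r u v → IsWalk u p x → IsWalk v q y →
    p.map (KGraph.Hom.onEdge X.map) = q.map (KGraph.Hom.onEdge X.map) → r x y

section Quotient

theorem total_comp_congr {C : Type*} [Category C] {x y z x' y' z' : C} {f : x ⟶ y} {g : y ⟶ z}
    {f' : x' ⟶ y'} {g' : y' ⟶ z'}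
    (hf : (⟨x, y, f⟩ : Quiver.Total C) = ⟨x', y', f'⟩)
    (hg : (⟨y, z, g⟩ : Quiver.Total C) = ⟨y', z', g'⟩) :
    (⟨x, z, f ≫ g⟩ : Quiver.Total C) = ⟨x', z', f' ≫ g'⟩ := by
  cases hf; cases hg; rfl

theorem isIdentity_of_deg {Δ : KGraph.{u} k} {x y : Δ.Ob} (f : x ⟶ y)
    (h : Δ.deg f = 0) : Path.IsIdentity (⟨x, y, f⟩ : Δ.Path) := by
  have h1 := (Δ.factorisation f 0 0 (by simpa using h)).unique
    (y₁ := ⟨x, 𝟙 x, f⟩) (y₂ := ⟨y, f, 𝟙 y⟩) (by simp [h, Δ.deg_id]) (by simp [h, Δ.deg_id])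
  cases h1
  exact ⟨_, rfl⟩

theorem deg_of_isIdentity {Δ : KGraph.{u} k} {x y : Δ.Ob} (f : x ⟶ y)
    (h : Path.IsIdentity (⟨x, y, f⟩ : Δ.Path)) : Δ.deg f = 0 := by
  obtain ⟨v, hv⟩ := h
  cases hv
  exact Δ.deg_id _

theorem total_comp_cancel {Δ : KGraph.{u} k} {x y z x' y' z' : Δ.Ob}
    {f : x ⟶ y} {g : y ⟶ z} {f' : x' ⟶ y'} {g' : y' ⟶ z'}
    (hc : (⟨x, z, f ≫ g⟩ : Δ.Path) = ⟨x', z', f' ≫ g'⟩)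
    (hf : Δ.deg f = Δ.deg f') (hg : Δ.deg g = Δ.deg g') :
    (⟨x, y, f⟩ : Δ.Path) = ⟨x', y', f'⟩ ∧ (⟨y, z, g⟩ : Δ.Path) = ⟨y', z', g'⟩ := by
  obtain rfl : x = x' := congrArg (fun t : Δ.Path => t.left) hc
  obtain rfl : z = z' := congrArg (fun t : Δ.Path => t.right) hc
  have hc' : f ≫ g = f' ≫ g' := by simpa using hc
  have := (Δ.factorisation (f ≫ g) _ _ (Δ.deg_comp f g)).unique
    (y₁ := ⟨y, f, g⟩) (y₂ := ⟨y', f', g'⟩) ⟨rfl, rfl, rfl⟩ ⟨hg.symm, hf.symm, hc'.symm⟩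
  cases this
  exact ⟨rfl, rfl⟩

variable {X : RepKGraph Λ} {r : Setoid X.graph.Ob}

theorem deg_eq_of_onPath_eq {e e' : X.graph.Path}
    (h : KGraph.Hom.onPath X.map e = KGraph.Hom.onPath X.map e') :
    X.graph.deg e.hom = X.graph.deg e'.hom := by
  have h2 := congrArg (fun t : Λ.Path => Λ.deg t.hom) h
  exact (X.map.deg_map e.hom).symm.trans (h2.trans (X.map.deg_map e'.hom))

theorem onPath_id_congr {u v : X.graph.Ob} (huv : X.map.obj u = X.map.obj v) :
    KGraph.Hom.onPath X.map ⟨u, u, 𝟙 u⟩ = KGraph.Hom.onPath X.map ⟨v, v, 𝟙 v⟩ := by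
  have hid : ∀ w, KGraph.Hom.onPath X.map ⟨w, w, 𝟙 w⟩ =
      (fun t : Λ.Ob => (⟨t, t, 𝟙 t⟩ : Λ.Path)) (X.map.obj w) := fun w => by
    simp [KGraph.Hom.onPath]
  rw [hid, hid, huv]

theorem IsAdmissible.exists_lift (h : IsAdmissible X r) {u : X.graph.Ob} (e : X.graph.Path)
    (hu : r u e.left) :
    ∃ e' : X.graph.Path, e'.left = u ∧
      KGraph.Hom.onPath X.map e' = KGraph.Hom.onPath X.map e := by
  have h1 : [Edge.pos (KGraph.Hom.onPath X.map e)] ∈ walkImage X.map e.left :=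
    ⟨[Edge.pos e], e.right, ⟨by simp, trivial, rfl, rfl⟩, rfl⟩
  rw [← h.walkImage_eq _ _ hu] at h1
  obtain ⟨p, v, hp, hpe⟩ := h1
  match p, hp, hpe with
  | [Edge.pos e'], hp, hpe =>
    refine ⟨e', hp.2.2.1, ?_⟩
    simpa [KGraph.Hom.onEdge] using hpe
  | [Edge.neg e'], hp, hpe => simp [KGraph.Hom.onEdge] at hpe
  | _ :: _ :: _, hp, hpe => simp at hpe

theorem IsAdmissible.obj_eq (h : IsAdmissible X r) {u v : X.graph.Ob} (huv : r u v) :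
    X.map.obj u = X.map.obj v := by
  obtain ⟨e', rfl, he⟩ := h.exists_lift ⟨v, v, 𝟙 v⟩ huv
  exact congrArg (fun t : Λ.Path => t.left) he

theorem IsAdmissible.right_rel (h : IsAdmissible X r) {e e' : X.graph.Path}
    (hl : r e.left e'.left)
    (he : KGraph.Hom.onPath X.map e = KGraph.Hom.onPath X.map e') : r e.right e'.right :=
  h.range_rel _ _ _ _ [Edge.pos e] [Edge.pos e'] hl ⟨by simp, trivial, rfl, rfl⟩
    ⟨by simp, trivial, rfl, rfl⟩ (by simp [KGraph.Hom.onEdge, he])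

theorem IsAdmissible.of_right_rel (h : IsAdmissible X r) {e e' : X.graph.Path}
    (hr : r e.right e'.right) (hd : X.graph.deg e.hom = X.graph.deg e'.hom) :
    r e.left e'.left ∧ KGraph.Hom.onPath X.map e = KGraph.Hom.onPath X.map e' := by
  by_cases hid : Path.IsIdentity e
  · have hid' : Path.IsIdentity e' :=
      isIdentity_of_deg _ (hd.symm.trans (deg_of_isIdentity _ hid))
    obtain ⟨v, rfl⟩ := hid
    obtain ⟨v', rfl⟩ := hid'
    refine ⟨hr, ?_⟩
    exact onPath_id_congr (h.obj_eq hr)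
  · have hw : IsWalk e.right [Edge.neg e] e.left := ⟨by simp, hid, rfl, rfl⟩
    have h1 : [Edge.neg (KGraph.Hom.onPath X.map e)] ∈ walkImage X.map e.right :=
      ⟨_, _, hw, rfl⟩
    rw [h.walkImage_eq _ _ hr] at h1
    obtain ⟨p, v, hp, hpe⟩ := h1
    match p, hp, hpe with
    | [Edge.pos e''], hp, hpe => simp [KGraph.Hom.onEdge] at hpe
    | _ :: _ :: _, hp, hpe => simp at hpe
    | [Edge.neg e''], hp, hpe =>
      have he : KGraph.Hom.onPath X.map e'' = KGraph.Hom.onPath X.map e := by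
        simpa [KGraph.Hom.onEdge] using hpe
      have hee : e'' = e' := by
        obtain ⟨a, b, f⟩ := e''
        obtain ⟨a', b', f'⟩ := e'
        obtain rfl : b = b' := hp.2.2.1
        have hdf : X.graph.deg f = X.graph.deg f' := (deg_eq_of_onPath_eq he).trans hd
        have := (X.existsUnique_range b (X.graph.deg f')).unique
          (y₁ := (⟨a, f⟩ : Quiver.Costar b)) (y₂ := (⟨a', f'⟩ : Quiver.Costar b)) hdf rfl
        cases this
        rfl
      subst hee
      have hv : v = e''.left := hp.2.2.2.symm
      subst hv
      exact ⟨h.range_rel _ _ _ _ _ _ hr hw hp (by simp [KGraph.Hom.onEdge, he]), he.symm⟩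

variable (X r)

/-- The equivalence relation induced by `r` on the paths: `δ ≈ δ'` if `s(δ) ≈ s(δ')` and
`α(δ) = α(δ')`. -/
def pathSetoid : Setoid X.graph.Path where
  r e e' := r e.left e'.left ∧ KGraph.Hom.onPath X.map e = KGraph.Hom.onPath X.map e'
  iseqv :=
    { refl := fun _ => ⟨r.refl _, rfl⟩
      symm := fun h => ⟨r.symm h.1, h.2.symm⟩
      trans := fun h h' => ⟨r.trans h.1 h'.1, h.2.trans h'.2⟩ }

variable {X r}

/-- The vertices of the quotient. -/
def QuotOb (_ : IsAdmissible X r) : Type u := Quotient r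

/-- The paths of the quotient. -/
def QuotPath (_ : IsAdmissible X r) : Type u := Quotient (pathSetoid X r)

variable (h : IsAdmissible X r)

/-- The class `[v]`. -/
def QuotOb.mk (v : X.graph.Ob) : QuotOb h := Quotient.mk r v

/-- The class `[δ]`. -/
def QuotPath.mk {x y : X.graph.Ob} (f : x ⟶ y) : QuotPath h :=
  Quotient.mk (pathSetoid X r) ⟨x, y, f⟩

variable {h}

/-- `s([δ]) = [s(δ)]` -/
def QuotPath.source (q : QuotPath h) : QuotOb h :=
  Quotient.lift (fun e : X.graph.Path => QuotOb.mk h e.left)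
    (fun e e' (he : (pathSetoid X r) e e') => Quotient.sound he.1) q

/-- `r([δ]) = [r(δ)]` -/
def QuotPath.range (q : QuotPath h) : QuotOb h :=
  Quotient.lift (fun e : X.graph.Path => QuotOb.mk h e.right)
    (fun e e' (he : (pathSetoid X r) e e') => Quotient.sound (h.right_rel he.1 he.2)) q

/-- `d([δ]) = d(δ)` -/
def QuotPath.deg (q : QuotPath h) : Fin k → ℕ :=
  Quotient.lift (fun e : X.graph.Path => X.graph.deg e.hom)
    (fun e e' (he : (pathSetoid X r) e e') => deg_eq_of_onPath_eq he.2) q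

/-- `α_≈([δ]) = α(δ)` -/
def QuotPath.image (q : QuotPath h) : Λ.Path :=
  Quotient.lift (fun e : X.graph.Path => KGraph.Hom.onPath X.map e)
    (fun e e' (he : (pathSetoid X r) e e') => he.2) q

/-- `α_≈([v]) = α(v)` -/
def QuotOb.image (a : QuotOb h) : Λ.Ob :=
  Quotient.lift (fun v : X.graph.Ob => X.map.obj v) (fun _ _ hv => h.obj_eq hv) a

theorem QuotPath.image_left (q : QuotPath h) : q.image.left = q.source.image := by
  obtain ⟨e, rfl⟩ := Quotient.exists_rep q
  rfl

theorem QuotPath.image_right (q : QuotPath h) : q.image.right = q.range.image := by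
  obtain ⟨e, rfl⟩ := Quotient.exists_rep q
  rfl

theorem QuotPath.eq_iff {x y x' y' : X.graph.Ob} {f : x ⟶ y} {f' : x' ⟶ y'} :
    QuotPath.mk h f = QuotPath.mk h f' ↔
      r x x' ∧ KGraph.Hom.onPath X.map ⟨x, y, f⟩ = KGraph.Hom.onPath X.map ⟨x', y', f'⟩ :=
  ⟨fun e => Quotient.exact e, fun e => Quotient.sound e⟩

theorem QuotPath.exists_rep (q : QuotPath h) :
    ∃ (x y : X.graph.Ob) (f : x ⟶ y), q = QuotPath.mk h f := by
  obtain ⟨e, rfl⟩ := Quotient.exists_rep q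
  exact ⟨_, _, e.hom, rfl⟩

theorem QuotPath.exists_rep_source (q : QuotPath h) (x : X.graph.Ob)
    (hq : q.source = QuotOb.mk h x) :
    ∃ (y : X.graph.Ob) (f : x ⟶ y), q = QuotPath.mk h f := by
  obtain ⟨e, rfl⟩ := Quotient.exists_rep q
  have hr : r e.left x := Quotient.exact hq
  obtain ⟨e', rfl, he⟩ := h.exists_lift e (r.symm hr)
  exact ⟨_, e'.hom, Quotient.sound ⟨hr, he.symm⟩⟩

theorem QuotPath.exists_rep_pair (q q' : QuotPath h) (hq : q'.source = q.range) :
    ∃ (x y z : X.graph.Ob) (f : x ⟶ y) (g : y ⟶ z),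
      q = QuotPath.mk h f ∧ q' = QuotPath.mk h g := by
  obtain ⟨x, y, f, rfl⟩ := q.exists_rep
  obtain ⟨z, g, hg⟩ := q'.exists_rep_source y hq
  exact ⟨x, y, z, f, g, rfl, hg⟩

theorem QuotPath.comp_congr {x y z x' y' z' : X.graph.Ob} {f : x ⟶ y} {g : y ⟶ z}
    {f' : x' ⟶ y'} {g' : y' ⟶ z'} (hf : QuotPath.mk h f = QuotPath.mk h f')
    (hg : QuotPath.mk h g = QuotPath.mk h g') :
    QuotPath.mk h (f ≫ g) = QuotPath.mk h (f' ≫ g') := by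
  rw [QuotPath.eq_iff] at *
  refine ⟨hf.1, ?_⟩
  simpa [KGraph.Hom.onPath] using total_comp_congr hf.2 hg.2

theorem QuotPath.exists_comp (q q' : QuotPath h) (hq : q'.source = q.range) :
    ∃ q'' : QuotPath h, ∀ (x y z : X.graph.Ob) (f : x ⟶ y) (g : y ⟶ z),
      q = QuotPath.mk h f → q' = QuotPath.mk h g → q'' = QuotPath.mk h (f ≫ g) := by
  obtain ⟨x, y, z, f, g, rfl, rfl⟩ := q.exists_rep_pair q' hq
  exact ⟨QuotPath.mk h (f ≫ g), fun _ _ _ _ _ hf hg => QuotPath.comp_congr hf hg⟩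

/-- The composite of two classes of paths: the class of the composite of any composable
representatives. -/
noncomputable def QuotPath.comp (q q' : QuotPath h) (hq : q'.source = q.range) : QuotPath h :=
  (q.exists_comp q' hq).choose

theorem QuotPath.comp_mk {x y z : X.graph.Ob} (f : x ⟶ y) (g : y ⟶ z) :
    (QuotPath.mk h f).comp (QuotPath.mk h g) rfl = QuotPath.mk h (f ≫ g) :=
  ((QuotPath.mk h f).exists_comp (QuotPath.mk h g) rfl).choose_spec _ _ _ f g rfl rfl

/-- The morphisms from `a` to `b` in the quotient. -/
def QuotHom (a b : QuotOb h) : Type u := {q : QuotPath h // q.source = a ∧ q.range = b}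

/-- The class of `f : x ⟶ y` as a morphism `[x] ⟶ [y]`. -/
def QuotHom.mk (h : IsAdmissible X r) {x y : X.graph.Ob} (f : x ⟶ y) :
    QuotHom (QuotOb.mk h x) (QuotOb.mk h y) := ⟨QuotPath.mk h f, rfl, rfl⟩

/-- The identity morphism `1_[v] = [1_v]`. -/
def QuotHom.id (a : QuotOb h) : QuotHom a a :=
  ⟨Quotient.lift (fun v : X.graph.Ob => QuotPath.mk h (𝟙 v))
      (fun u v huv => QuotPath.eq_iff.2 ⟨huv, onPath_id_congr (h.obj_eq huv)⟩) a, by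
    obtain ⟨v, rfl⟩ := Quotient.exists_rep a
    exact ⟨rfl, rfl⟩⟩

theorem comp_endpoints (q q' : QuotPath h) (hq : q'.source = q.range) :
    (q.comp q' hq).source = q.source ∧ (q.comp q' hq).range = q'.range := by
  obtain ⟨x, y, z, f, g, rfl, rfl⟩ := q.exists_rep_pair q' hq
  rw [QuotPath.comp_mk]
  exact ⟨rfl, rfl⟩

noncomputable def QuotHom.comp {a b c : QuotOb h} (F : QuotHom a b) (G : QuotHom b c) :
    QuotHom a c :=
  ⟨F.1.comp G.1 (G.2.1.trans F.2.2.symm),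
    (comp_endpoints _ _ _).1.trans F.2.1, (comp_endpoints _ _ _).2.trans G.2.2⟩

theorem QuotHom.exists_rep {x : X.graph.Ob} {b : QuotOb h} (F : QuotHom (QuotOb.mk h x) b) :
    ∃ (y : X.graph.Ob) (hy : b = QuotOb.mk h y) (f : x ⟶ y), hy ▸ F = QuotHom.mk h f := by
  obtain ⟨q, hs, rfl⟩ := F
  obtain ⟨y, f, rfl⟩ := q.exists_rep_source x hs
  exact ⟨y, rfl, f, rfl⟩

theorem QuotHom.comp_mk {x y z : X.graph.Ob} (f : x ⟶ y) (g : y ⟶ z) :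
    (QuotHom.mk h f).comp (QuotHom.mk h g) = QuotHom.mk h (f ≫ g) :=
  Subtype.ext (QuotPath.comp_mk f g)

noncomputable instance quotCategory : SmallCategory (QuotOb h) where
  Hom := QuotHom
  id := QuotHom.id
  comp := QuotHom.comp
  id_comp {a b} F := by
    obtain ⟨x, rfl⟩ := Quotient.exists_rep a
    obtain ⟨y, rfl, f, hf⟩ := QuotHom.exists_rep (x := x) F
    obtain rfl : F = QuotHom.mk h f := hf
    exact (QuotHom.comp_mk (h := h) (𝟙 x) f).trans (by rw [Category.id_comp])
  comp_id {a b} F := by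
    obtain ⟨x, rfl⟩ := Quotient.exists_rep a
    obtain ⟨y, rfl, f, hf⟩ := QuotHom.exists_rep (x := x) F
    obtain rfl : F = QuotHom.mk h f := hf
    exact (QuotHom.comp_mk (h := h) f (𝟙 y)).trans (by rw [Category.comp_id])
  assoc {a b c d} F G H := by
    obtain ⟨x, rfl⟩ := Quotient.exists_rep a
    obtain ⟨y, rfl, f, hf⟩ := QuotHom.exists_rep (x := x) F
    obtain rfl : F = QuotHom.mk h f := hf
    obtain ⟨z, rfl, g, hg⟩ := QuotHom.exists_rep (x := y) G
    obtain rfl : G = QuotHom.mk h g := hg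
    obtain ⟨w, rfl, l, hl⟩ := QuotHom.exists_rep (x := z) H
    obtain rfl : H = QuotHom.mk h l := hl
    change (((QuotHom.mk h f).comp (QuotHom.mk h g)).comp (QuotHom.mk h l)) =
      (QuotHom.mk h f).comp ((QuotHom.mk h g).comp (QuotHom.mk h l))
    simp only [QuotHom.comp_mk, Category.assoc]

/-- The projection functor onto the quotient. -/
noncomputable def quotProj (h : IsAdmissible X r) : X.graph.Ob ⥤ QuotOb h where
  obj := QuotOb.mk h
  map f := QuotHom.mk h f
  map_id _ := rfl
  map_comp f g := (QuotHom.comp_mk f g).symm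

theorem quotPair_ext {a b z z' : QuotOb h} {F : a ⟶ z} {G : z ⟶ b} {F' : a ⟶ z'} {G' : z' ⟶ b}
    (hF : F.1 = F'.1) (hG : G.1 = G'.1) :
    (⟨z, F, G⟩ : Σ z : QuotOb h, (a ⟶ z) × (z ⟶ b)) = ⟨z', F', G'⟩ := by
  obtain ⟨F, hs, rfl⟩ := F
  obtain ⟨F', hs', rfl⟩ := F'
  obtain rfl : F = F' := hF
  obtain rfl : G = G' := Subtype.ext hG
  rfl

theorem quot_existsUnique_range (b : QuotOb h) (n : Fin k → ℕ) :
    ∃! p : Quiver.Costar b, QuotPath.deg p.2.1 = n := by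
  obtain ⟨y, rfl⟩ := Quotient.exists_rep b
  obtain ⟨⟨x, f⟩, hf, -⟩ := X.existsUnique_range y n
  refine ⟨⟨QuotOb.mk h x, QuotHom.mk h f⟩, hf, ?_⟩
  rintro ⟨a, q, rfl, hb⟩ hq
  obtain ⟨x', y', f', rfl⟩ := q.exists_rep
  have hr : r y' y := Quotient.exact hb
  have key := h.of_right_rel (e := ⟨x', y', f'⟩) (e' := ⟨x, y, f⟩) hr (Eq.trans hq hf.symm)
  have hp : QuotPath.mk h f' = QuotPath.mk h f := QuotPath.eq_iff.2 key
  have gen : ∀ (q q' : QuotPath h) (hb : q.range = QuotOb.mk h y)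
      (hb' : q'.range = QuotOb.mk h y), q = q' →
      (⟨q.source, ⟨q, rfl, hb⟩⟩ : Quiver.Costar (QuotOb.mk h y)) =
        ⟨q'.source, ⟨q', rfl, hb'⟩⟩ := by
    rintro q q' hb hb' rfl
    rfl
  exact gen _ _ hb rfl hp

theorem quot_factorisation {a b : QuotOb h} (F : a ⟶ b) (m n : Fin k → ℕ)
    (hF : QuotPath.deg F.1 = m + n) :
    ∃! p : Σ z : QuotOb h, (a ⟶ z) × (z ⟶ b),
      QuotPath.deg p.2.2.1 = m ∧ QuotPath.deg p.2.1.1 = n ∧ p.2.1 ≫ p.2.2 = F := by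
  obtain ⟨x, rfl⟩ := Quotient.exists_rep a
  obtain ⟨y, rfl, f, hf⟩ := QuotHom.exists_rep (x := x) F
  obtain rfl : F = QuotHom.mk h f := hf
  obtain ⟨⟨z, f₁, f₂⟩, ⟨hm, hn, hc⟩, -⟩ := X.graph.factorisation f m n hF
  refine ⟨⟨QuotOb.mk h z, QuotHom.mk h f₁, QuotHom.mk h f₂⟩, ⟨hm, hn, ?_⟩, ?_⟩
  · exact (QuotHom.comp_mk f₁ f₂).trans (congrArg (QuotHom.mk h) hc)
  rintro ⟨c, G₁, G₂⟩ ⟨hm', hn', hc'⟩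
  obtain ⟨z', rfl, g₁, hg₁⟩ := QuotHom.exists_rep (x := x) G₁
  obtain rfl : G₁ = QuotHom.mk h g₁ := hg₁
  obtain ⟨y', g₂, hg₂⟩ := G₂.1.exists_rep_source z' G₂.2.1
  have hcc : QuotPath.mk h (g₁ ≫ g₂) = QuotPath.mk h (f₁ ≫ f₂) := by
    rw [hc]
    refine Eq.trans ?_ (congrArg Subtype.val hc')
    obtain ⟨G₂, hs, hr⟩ := G₂
    obtain rfl : G₂ = QuotPath.mk h g₂ := hg₂
    exact (QuotPath.comp_mk g₁ g₂).symm
  have hd₁ : X.graph.deg g₁ = X.graph.deg f₁ := Eq.trans hn' hn.symm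
  have hd₂ : X.graph.deg g₂ = X.graph.deg f₂ := by
    refine Eq.trans ?_ (Eq.trans hm' hm.symm)
    exact (congrArg QuotPath.deg hg₂).symm
  rw [QuotPath.eq_iff] at hcc
  have hcc2 := hcc.2
  simp only [KGraph.Hom.onPath, Functor.map_comp] at hcc2
  have key := total_comp_cancel hcc2
    (by rw [X.map.deg_map, X.map.deg_map, hd₁]) (by rw [X.map.deg_map, X.map.deg_map, hd₂])
  have h1 : QuotPath.mk h g₁ = QuotPath.mk h f₁ := QuotPath.eq_iff.2 ⟨hcc.1, key.1⟩
  have h2 : QuotPath.mk h g₂ = QuotPath.mk h f₂ := by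
    refine QuotPath.eq_iff.2 ⟨?_, key.2⟩
    exact h.right_rel (e := ⟨x, z', g₁⟩) (e' := ⟨x, z, f₁⟩) hcc.1 key.1
  exact quotPair_ext h1 (hg₂.trans h2)

theorem quot_isConnected : IsConnected (QuotOb h) := by
  have : Nonempty (QuotOb h) :=
    ⟨QuotOb.mk h (Classical.arbitrary X.graph.Ob)⟩
  refine zigzag_isConnected fun a b => ?_
  obtain ⟨x, rfl⟩ := Quotient.exists_rep a
  obtain ⟨y, rfl⟩ := Quotient.exists_rep b
  exact zigzag_obj_of_zigzag (quotProj h) (isPreconnected_zigzag x y)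

theorem quot_deg_comp {a b c : QuotOb h} (F : a ⟶ b) (G : b ⟶ c) :
    QuotPath.deg (F ≫ G).1 = QuotPath.deg G.1 + QuotPath.deg F.1 := by
  obtain ⟨x, rfl⟩ := Quotient.exists_rep a
  obtain ⟨y, rfl, f, hf⟩ := QuotHom.exists_rep (x := x) F
  obtain rfl : F = QuotHom.mk h f := hf
  obtain ⟨z, rfl, g, hg⟩ := QuotHom.exists_rep (x := y) G
  obtain rfl : G = QuotHom.mk h g := hg
  exact (congrArg QuotPath.deg (QuotPath.comp_mk f g)).trans (X.graph.deg_comp f g)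

/-- The `k`-graph `Δ_≈`. -/
noncomputable def quotGraph (h : IsAdmissible X r) : KGraph.{u} k where
  Ob := QuotOb h
  cat := quotCategory
  deg {a b} F := QuotPath.deg (Subtype.val (show QuotHom (h := h) a b from F))
  deg_id a := by
    obtain ⟨x, rfl⟩ := Quotient.exists_rep a
    exact X.graph.deg_id x
  deg_comp := quot_deg_comp
  factorisation F m n hF := quot_factorisation F m n hF
  connected := quot_isConnected
  rowFinite b n := by
    obtain ⟨p, -, hu⟩ := quot_existsUnique_range b n
    exact (Set.finite_singleton p).subset fun q hq => hu q hq
  noSources b n := (quot_existsUnique_range b n).exists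

/-- The functor `α_≈` on morphisms; the composition with `eqToHom` only adjusts the (equal) source
and range. -/
def quotMap {a b : QuotOb h} (F : QuotHom a b) : a.image ⟶ b.image :=
  eqToHom (by rw [F.1.image_left, F.2.1]) ≫ F.1.image.hom ≫
    eqToHom (by rw [F.1.image_right, F.2.2])

theorem quotMap_mk {x y : X.graph.Ob} (f : x ⟶ y) :
    quotMap (QuotHom.mk h f) = X.map.map f :=
  (Category.id_comp _).trans (Category.comp_id _)

/-- The functor `α_≈`, given by `[v] ↦ α(v)` and `[δ] ↦ α(δ)`. -/
noncomputable def quotFunctor (h : IsAdmissible X r) : QuotOb h ⥤ Λ.Ob where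
  obj a := a.image
  map F := quotMap F
  map_id a := by
    obtain ⟨x, rfl⟩ := Quotient.exists_rep a
    exact (quotMap_mk (h := h) (𝟙 x)).trans (X.map.map_id x)
  map_comp {a b c} F G := by
    obtain ⟨x, rfl⟩ := Quotient.exists_rep a
    obtain ⟨y, rfl, f, hf⟩ := QuotHom.exists_rep (x := x) F
    obtain rfl : F = QuotHom.mk h f := hf
    obtain ⟨z, rfl, g, hg⟩ := QuotHom.exists_rep (x := y) G
    obtain rfl : G = QuotHom.mk h g := hg
    exact (((congrArg quotMap (QuotHom.comp_mk f g)).trans (quotMap_mk _)).trans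
      (X.map.map_comp f g)).trans
      (congrArg₂ (· ≫ ·) (quotMap_mk f).symm (quotMap_mk g).symm)

/-- The morphism of `k`-graphs `α_≈ : Δ_≈ ⟶ Λ`. -/
noncomputable def quotHom (h : IsAdmissible X r) : quotGraph h ⟶ Λ where
  toFunctor := quotFunctor h
  deg_map {a b} F := by
    obtain ⟨x, rfl⟩ := Quotient.exists_rep a
    obtain ⟨y, rfl, f, hf⟩ := QuotHom.exists_rep (x := x) F
    obtain rfl : F = QuotHom.mk h f := hf
    exact (congrArg Λ.deg (quotMap_mk f)).trans (X.map.deg_map f)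

theorem quot_bijective_source (a : QuotOb h) :
    Function.Bijective ((quotFunctor h).toPrefunctor.star a) := by
  obtain ⟨x, rfl⟩ := Quotient.exists_rep a
  have hmk : ∀ {y : X.graph.Ob} (f : x ⟶ y),
      (quotFunctor h).toPrefunctor.star (QuotOb.mk h x) ⟨QuotOb.mk h y, QuotHom.mk h f⟩ =
        X.map.toPrefunctor.star x ⟨y, f⟩ := fun {y} f =>
    congrArg (fun t => (⟨X.map.obj y, t⟩ : Quiver.Star (X.map.obj x))) (quotMap_mk f)
  constructor
  · rintro ⟨b, F⟩ ⟨b', F'⟩ hFF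
    obtain ⟨y, rfl, f, hf⟩ := QuotHom.exists_rep (x := x) F
    obtain rfl : F = QuotHom.mk h f := hf
    obtain ⟨y', rfl, f', hf'⟩ := QuotHom.exists_rep (x := x) F'
    obtain rfl : F' = QuotHom.mk h f' := hf'
    have := (X.bijective_source x).1 (((hmk f).symm.trans hFF).trans (hmk f'))
    cases this
    rfl
  · intro q
    obtain ⟨⟨y, f⟩, hf⟩ := (X.bijective_source x).2 q
    exact ⟨⟨QuotOb.mk h y, QuotHom.mk h f⟩, (hmk f).trans hf⟩

/-- The quotient `(Δ_≈, α_≈)` of `(Δ, α)` by an admissible equivalence relation. -/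
noncomputable def quotient (X : RepKGraph Λ) (r : Setoid X.graph.Ob) (h : IsAdmissible X r) :
    RepKGraph Λ where
  graph := quotGraph h
  map := quotHom h
  bijective_source a := quot_bijective_source (h := h) a
  existsUnique_range b n := quot_existsUnique_range (h := h) b n

end Quotient

/-- `Y` is isomorphic to a quotient of `X`. -/
def IsIsoToQuotient (Y X : RepKGraph Λ) : Prop :=
  ∃ (r : Setoid X.graph.Ob) (h : IsAdmissible X r), Nonempty (Y ≅ X.quotient r h)

end RepKGraph

/-- An object of a category is repelling if it maps to every object. -/
def IsRepelling {C : Type*} [Category C] (X : C) : Prop :=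
  ∀ Y : C, Nonempty (X ⟶ Y)

end HigherRank

/-! Every morphism of representation `k`-graphs is a covering (`isCovering_hom`): bijectivity on
paths with given source cancels over `Λ`, and paths with given range are classified by their degree.
The theorem thus becomes covering theory.

A covering induces a functor from its base to sets and bijections (`IsCovering.fibre`). Such a
functor extends to the free groupoid on the base. The vertices of `universalCover` are the groupoid
morphisms out of a base vertex, so transporting a point of a fibre along them lifts any morphism
through any covering of its target (`exists_universalCover_lift`).

For the repelling property, a morphism from the covering is carried along a zigzag in `C`: forward
arrows are composed with, backward arrows are coverings and are lifted through
(`nonempty_hom_of_zigzag`). Finally, a morphism out of `X` is surjective on vertices and its fibres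
form an admissible relation, so its target is the quotient of `X` by that relation
(`isIsoToQuotient_of_hom`). Conversely, quotients receive a projection and stay in `C`. -/

namespace HigherRank

variable {k : ℕ}

namespace KGraph

/-! ### Lifting paths and constructing morphisms from vertex maps. -/

section Lifting

variable {S B W : KGraph.{u} k} {β : S ⟶ B}

/-- Paths are compared with their endpoints bundled, so that vertices which are only propositionally
equal require no transport of morphisms. -/
theorem eq_of_onPath_eq_of_left_eq (hβ : ∀ v, Function.Injective (β.toPrefunctor.star v))
    {e e' : S.Path} (hl : e.left = e'.left) (he : Hom.onPath β e = Hom.onPath β e') : e = e' := by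
  obtain ⟨x, y, f⟩ := e
  obtain ⟨x', y', f'⟩ := e'
  obtain rfl : x = x' := hl
  have key : (⟨y, f⟩ : Quiver.Star x) = ⟨y', f'⟩ := by
    apply hβ x
    simp only [Hom.onPath, Quiver.Total.mk.injEq] at he
    exact Sigma.ext he.2.1 he.2.2
  cases key
  rfl

theorem eq_of_onPath_eq_of_right_eq (hβ : ∀ v, Function.Injective (β.toPrefunctor.costar v))
    {e e' : S.Path} (hr : e.right = e'.right) (he : Hom.onPath β e = Hom.onPath β e') :
    e = e' := by
  obtain ⟨x, y, f⟩ := e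
  obtain ⟨x', y', f'⟩ := e'
  obtain rfl : y = y' := hr
  have key : (⟨x, f⟩ : Quiver.Costar y) = ⟨x', f'⟩ := by
    apply hβ y
    simp only [Hom.onPath, Quiver.Total.mk.injEq] at he
    exact Sigma.ext he.1 he.2.2
  cases key
  rfl

theorem exists_lift_left (hβ : ∀ v, Function.Surjective (β.toPrefunctor.star v))
    {s : S.Ob} {e : B.Path} (hs : β.obj s = e.left) :
    ∃ (t : S.Ob) (h : s ⟶ t), Hom.onPath β ⟨s, t, h⟩ = e := by
  obtain ⟨x, y, f⟩ := e
  obtain rfl : β.obj s = x := hs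
  obtain ⟨⟨t, h⟩, hh⟩ := hβ s ⟨y, f⟩
  exact ⟨t, h, congrArg (fun p : Quiver.Star (β.obj s) => (⟨_, _, p.2⟩ : B.Path)) hh⟩

theorem exists_lift_right (hβ : ∀ v, Function.Surjective (β.toPrefunctor.costar v))
    {t : S.Ob} {e : B.Path} (ht : β.obj t = e.right) :
    ∃ (s : S.Ob) (h : s ⟶ t), Hom.onPath β ⟨s, t, h⟩ = e := by
  obtain ⟨x, y, f⟩ := e
  obtain rfl : β.obj t = y := ht
  obtain ⟨⟨s, h⟩, hh⟩ := hβ t ⟨x, f⟩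
  exact ⟨s, h, congrArg (fun p : Quiver.Costar (β.obj t) => (⟨_, _, p.2⟩ : B.Path)) hh⟩

theorem onPath_id (φ : S ⟶ B) (s : S.Ob) :
    Hom.onPath φ ⟨s, s, 𝟙 s⟩ = ⟨φ.obj s, φ.obj s, 𝟙 _⟩ := by
  simp [Hom.onPath]

theorem onPath_comp (φ : S ⟶ B) {x y z : S.Ob} (f : x ⟶ y) (g : y ⟶ z) :
    Hom.onPath φ ⟨x, z, f ≫ g⟩ = ⟨φ.obj x, φ.obj z, φ.map f ≫ φ.map g⟩ := by
  simp [Hom.onPath]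

theorem hom_ext_of_onPath {φ ψ : S ⟶ B} (h : ∀ e, Hom.onPath φ e = Hom.onPath ψ e) : φ = ψ := by
  have hF : φ.toFunctor = ψ.toFunctor := by
    refine Functor.hext (fun x => congrArg Quiver.Total.left (h ⟨x, x, 𝟙 x⟩)) fun x y f => ?_
    have := h ⟨x, y, f⟩
    simp only [Hom.onPath, Quiver.Total.mk.injEq] at this
    exact this.2.2
  have ext (a b : KGraph.Hom S B) (h : a.toFunctor = b.toFunctor) : a = b := by
    cases a; cases b; cases h; rfl
  exact ext φ ψ hF

theorem onPath_comp_hom (φ : W ⟶ S) (ψ : S ⟶ B) (e : W.Path) :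
    Hom.onPath (φ ≫ ψ) e = Hom.onPath ψ (Hom.onPath φ e) := rfl

/-- Two morphisms over `B` into a `k`-graph with injective star maps agree if they agree on
vertices. -/
theorem hom_ext_of_obj (hβ : ∀ v, Function.Injective (β.toPrefunctor.star v)) {φ ψ : W ⟶ S}
    (hobj : ∀ x, φ.obj x = ψ.obj x) (h : φ ≫ β = ψ ≫ β) : φ = ψ :=
  hom_ext_of_onPath fun e => eq_of_onPath_eq_of_left_eq hβ (hobj e.left) <| by
    rw [← onPath_comp_hom, ← onPath_comp_hom, h]

/-- A map on vertices along which all paths can be lifted extends to a morphism over `B`. -/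
theorem exists_hom_of_obj (hβ : ∀ v, Function.Injective (β.toPrefunctor.star v)) (γ : W ⟶ B)
    (o : W.Ob → S.Ob) (ho : ∀ {x y : W.Ob} (f : x ⟶ y),
      ∃ g : o x ⟶ o y, Hom.onPath β ⟨_, _, g⟩ = Hom.onPath γ ⟨x, y, f⟩) :
    ∃ φ : W ⟶ S, φ ≫ β = γ ∧ ∀ x, φ.obj x = o x := by
  choose m hm using @ho
  -- A lift is determined by its source and its image, so the functor laws need only be checked in
  -- `B`.
  have inj {x y : W.Ob} {g g' : o x ⟶ o y}
      (h : Hom.onPath β ⟨_, _, g⟩ = Hom.onPath β ⟨_, _, g'⟩) : g = g' := by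
    simpa using eq_of_onPath_eq_of_left_eq hβ (e := ⟨_, _, g⟩) (e' := ⟨_, _, g'⟩) rfl h
  let φ : W ⟶ S :=
    { obj := o
      map := m
      map_id := fun x => inj <| by
        rw [hm, onPath_id, onPath_id]
        have := congrArg Quiver.Total.left (hm (𝟙 x))
        change β.obj (o x) = γ.obj x at this
        rw [this]
      map_comp := fun f g => inj <| by
        rw [hm, onPath_comp, onPath_comp]
        exact RepKGraph.total_comp_congr (hm f).symm (hm g).symm
      deg_map := fun {x y} f => by
        have := congrArg (fun p : B.Path => B.deg p.hom) (hm f)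
        exact (β.deg_map _).symm.trans (this.trans (γ.deg_map f)) }
  exact ⟨φ, hom_ext_of_onPath fun e => hm e.hom, fun _ => rfl⟩

/-- The image is nonempty and closed under following paths in both directions, by lifting; the base
is connected. -/
theorem IsCovering.surjective_obj (hβ : IsCovering β) : Function.Surjective β.obj := by
  intro b
  obtain ⟨s⟩ := S.connected.is_nonempty
  refine induct_on_objects (Set.range β.obj) (j₀ := β.obj s) ⟨s, rfl⟩ (fun {x y} f => ⟨?_, ?_⟩) b
  · rintro ⟨t, ht⟩
    obtain ⟨t', h, hh⟩ := exists_lift_left (fun v => (hβ.star_bijective v).2)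
      (e := ⟨x, y, f⟩) ht
    exact ⟨t', congrArg Quiver.Total.right hh⟩
  · rintro ⟨t, ht⟩
    obtain ⟨t', h, hh⟩ := exists_lift_right (fun v => (hβ.costar_bijective v).2)
      (e := ⟨x, y, f⟩) ht
    exact ⟨t', congrArg Quiver.Total.left hh⟩

end Lifting

/-! ### Fibre transport of a covering. -/

section Fibre

variable {S B : KGraph.{u} k} {β : S ⟶ B}

/-- Transport along the lifts of a path is a bijection between the fibres of a covering. -/
theorem IsCovering.exists_equiv (hβ : IsCovering β) {x y : B.Ob} (f : x ⟶ y) :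
    ∃ E : {s // β.obj s = x} ≃ {s // β.obj s = y}, ∀ s : {s // β.obj s = x},
      ∃ h : s.1 ⟶ (E s).1, Hom.onPath β ⟨_, _, h⟩ = ⟨x, y, f⟩ := by
  have H (s : {s // β.obj s = x}) : ∃ (t : {s // β.obj s = y}) (h : s.1 ⟶ t.1),
      Hom.onPath β ⟨_, _, h⟩ = ⟨x, y, f⟩ := by
    obtain ⟨t, h, hh⟩ := exists_lift_left (fun v => (hβ.star_bijective v).2)
      (e := ⟨x, y, f⟩) s.2
    exact ⟨⟨t, congrArg Quiver.Total.right hh⟩, h, hh⟩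
  choose F m hm using H
  refine ⟨Equiv.ofBijective F ⟨fun s s' hs => ?_, fun t => ?_⟩, fun s => ⟨m s, hm s⟩⟩
  -- Injectivity is uniqueness of lifts with given range; surjectivity below comes from their
  -- existence.
  · have := eq_of_onPath_eq_of_right_eq (fun v => (hβ.costar_bijective v).1)
      (e := ⟨_, _, m s⟩) (e' := ⟨_, _, m s'⟩) (congrArg Subtype.val hs)
      ((hm s).trans (hm s').symm)
    exact Subtype.ext (congrArg Quiver.Total.left this)
  · obtain ⟨s, h, hh⟩ := exists_lift_right (fun v => (hβ.costar_bijective v).2)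
      (e := ⟨x, y, f⟩) t.2
    have hs : β.obj s = x := congrArg Quiver.Total.left hh
    refine ⟨⟨s, hs⟩, Subtype.ext ?_⟩
    have := eq_of_onPath_eq_of_left_eq (fun v => (hβ.star_bijective v).1)
      (e := ⟨_, _, m ⟨s, hs⟩⟩) (e' := ⟨_, _, h⟩) rfl ((hm _).trans hh.symm)
    exact congrArg Quiver.Total.right this

/-- The transport along the lifts of `f`. -/
noncomputable def IsCovering.transport (hβ : IsCovering β) {x y : B.Ob} (f : x ⟶ y) :
    {s // β.obj s = x} ≃ {s // β.obj s = y} :=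
  (hβ.exists_equiv f).choose

theorem IsCovering.exists_transport (hβ : IsCovering β) {x y : B.Ob} (f : x ⟶ y)
    (s : {s // β.obj s = x}) :
    ∃ h : s.1 ⟶ (hβ.transport f s).1, Hom.onPath β ⟨_, _, h⟩ = ⟨x, y, f⟩ :=
  (hβ.exists_equiv f).choose_spec s

theorem IsCovering.transport_eq (hβ : IsCovering β) {x y : B.Ob} {f : x ⟶ y}
    {s : {s // β.obj s = x}} {t : {s // β.obj s = y}} (h : s.1 ⟶ t.1)
    (hh : Hom.onPath β ⟨_, _, h⟩ = ⟨x, y, f⟩) : hβ.transport f s = t := by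
  obtain ⟨h', hh'⟩ := hβ.exists_transport f s
  have := eq_of_onPath_eq_of_left_eq (fun v => (hβ.star_bijective v).1)
      (e := ⟨_, _, h'⟩) (e' := ⟨_, _, h⟩) rfl (hh'.trans hh.symm)
  exact Subtype.ext (congrArg Quiver.Total.right this)

/-- The fibres of a covering, as a functor to the groupoid of sets and bijections. -/
noncomputable def IsCovering.fibre (hβ : IsCovering β) : B.Ob ⥤ Core (Type u) where
  obj x := ⟨{s // β.obj s = x}⟩
  map f := ⟨(hβ.transport f).toIso⟩
  map_id x := by
    ext s
    refine congrArg Subtype.val (hβ.transport_eq (𝟙 s.1) ?_ : hβ.transport (𝟙 x) s = s)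
    rw [onPath_id, s.2]
  map_comp {x y z} f g := by
    ext s
    obtain ⟨h, hh⟩ := hβ.exists_transport f s
    obtain ⟨h', hh'⟩ := hβ.exists_transport g (hβ.transport f s)
    refine congrArg Subtype.val (hβ.transport_eq (h ≫ h') ?_ :
      hβ.transport (f ≫ g) s = hβ.transport g (hβ.transport f s))
    rw [onPath_comp]
    exact RepKGraph.total_comp_congr hh hh'

end Fibre

/-! ### The universal covering -/

section UniversalCover

variable (Δ : KGraph.{u} k) (v : Δ.Ob)

/-- The vertices of the universal covering: the homotopy classes of walks starting in `v`. -/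
structure UniversalOb where
  base : Δ.Ob
  cls : FreeGroupoid.mk v ⟶ FreeGroupoid.mk base

variable {Δ v}

instance : SmallCategory (UniversalOb Δ v) where
  Hom p q := {f : p.base ⟶ q.base // p.cls ≫ FreeGroupoid.homMk f = q.cls}
  id p := ⟨𝟙 _, by simp⟩
  comp f g := ⟨f.1 ≫ g.1, by
    rw [FreeGroupoid.homMk, Functor.map_comp, ← Category.assoc, f.2, g.2]⟩

namespace UniversalOb

theorem hom_ext {p q : UniversalOb Δ v} {f g : p ⟶ q} (h : f.1 = g.1) : f = g := Subtype.ext h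

variable (Δ v) in
/-- The projection of the universal covering. -/
def proj : UniversalOb Δ v ⥤ Δ.Ob where
  obj p := p.base
  map f := f.1

/-- The end of the lift of `f` starting in `p`. -/
def extend (p : UniversalOb Δ v) {y : Δ.Ob} (f : p.base ⟶ y) : UniversalOb Δ v :=
  ⟨y, p.cls ≫ FreeGroupoid.homMk f⟩

/-- The lift of `f` starting in `p`. -/
def extendHom (p : UniversalOb Δ v) {y : Δ.Ob} (f : p.base ⟶ y) : p ⟶ p.extend f := ⟨f, rfl⟩

theorem star_proj_bijective (p : UniversalOb Δ v) :
    Function.Bijective ((proj Δ v).toPrefunctor.star p) := by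
  refine ⟨?_, fun ⟨y, f⟩ => ⟨⟨p.extend f, p.extendHom f⟩, rfl⟩⟩
  rintro ⟨⟨x, a⟩, f, hf⟩ ⟨⟨y, b⟩, g, hg⟩ h
  obtain rfl : x = y := congrArg Sigma.fst h
  obtain rfl : f = g := eq_of_heq (Sigma.mk.inj h).2
  obtain rfl := hf.symm.trans hg
  rfl

theorem costar_proj_bijective (p : UniversalOb Δ v) :
    Function.Bijective ((proj Δ v).toPrefunctor.costar p) := by
  refine ⟨?_, fun ⟨x, f⟩ => ⟨⟨⟨x, p.cls ≫ inv (FreeGroupoid.homMk f)⟩, f, by simp⟩, rfl⟩⟩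
  rintro ⟨⟨x, a⟩, f, hf⟩ ⟨⟨y, b⟩, g, hg⟩ h
  obtain rfl : x = y := congrArg Sigma.fst h
  obtain rfl : f = g := eq_of_heq (Sigma.mk.inj h).2
  obtain rfl : a = b := (cancel_mono (FreeGroupoid.homMk f)).1 (hf.trans hg.symm)
  rfl

/-- Each initial segment of the path represents a vertex. A forward edge gives a morphism from the
previous vertex, a reversed edge a morphism back to it. -/
theorem zigzag_of_path {w : Quiver.Symmetrify Δ.Ob}
    (p : Quiver.Path (V := Quiver.Symmetrify Δ.Ob) v w) :
    Zigzag (⟨v, 𝟙 _⟩ : UniversalOb Δ v)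
      ⟨w, (Quotient.functor (FreeGroupoid.homRel Δ.Ob)).map
        ((Quotient.functor (Quiver.FreeGroupoid.redStep (V := Δ.Ob))).map p)⟩ := by
  induction p with
  | nil => rfl
  | cons p e ih =>
    rcases e with f | f
    · exact ih.trans (Zigzag.of_hom ⟨f, rfl⟩)
    · refine ih.trans (Zigzag.of_inv ⟨f, ?_⟩)
      -- Appending the reversed edge composes with the inverse of `f`, so `f` leads from the new
      -- vertex back to the old one.
      change ((show FreeGroupoid.mk v ⟶ FreeGroupoid.mk _ from
        (Quotient.functor (FreeGroupoid.homRel Δ.Ob)).map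
          ((Quotient.functor (Quiver.FreeGroupoid.redStep (V := Δ.Ob))).map p)) ≫
        Groupoid.inv (FreeGroupoid.homMk f)) ≫ FreeGroupoid.homMk f = _
      rw [Category.assoc, Groupoid.inv_comp, Category.comp_id]

instance : IsConnected (UniversalOb Δ v) := by
  have : Nonempty (UniversalOb Δ v) := ⟨⟨v, 𝟙 _⟩⟩
  have key (p : UniversalOb Δ v) : Zigzag ⟨v, 𝟙 _⟩ p := by
    obtain ⟨w, a⟩ := p
    -- The free groupoid on a category is a quotient of the free groupoid on its quiver, itself a
    -- quotient of paths in the symmetrified quiver; hence every class is represented by such a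
    -- path.
    obtain ⟨a, rfl⟩ := (Quotient.functor (FreeGroupoid.homRel Δ.Ob)).map_surjective a
    obtain ⟨a, rfl⟩ := (Quotient.functor (Quiver.FreeGroupoid.redStep (V := Δ.Ob))).map_surjective a
    exact zigzag_of_path a
  exact zigzag_isConnected fun p q => (key p).symm.trans (key q)

end UniversalOb

variable (Δ v)

/-- The universal covering of a `k`-graph. -/
def universalCover : KGraph.{u} k where
  Ob := UniversalOb Δ v
  deg {p q} f := Δ.deg (show {f : p.base ⟶ q.base // _} from f).1
  deg_id p := Δ.deg_id _
  deg_comp f g := Δ.deg_comp _ _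
  factorisation {p q} f m n hf := by
    obtain ⟨⟨z, g, h⟩, ⟨hm, hn, hc⟩, hu⟩ := Δ.factorisation f.1 m n hf
    dsimp only at hm hn hc
    -- The factorisation in `Δ` is lifted from `p`; the class at the middle vertex is forced by the
    -- first factor, which also gives uniqueness.
    refine ⟨⟨p.extend g, p.extendHom g, ⟨h, ?_⟩⟩, ⟨hm, hn, UniversalOb.hom_ext hc⟩, ?_⟩
    · refine (Category.assoc p.cls (FreeGroupoid.homMk g) (FreeGroupoid.homMk h)).trans ?_
      rw [← Functor.map_comp, hc, f.2]
    · rintro ⟨⟨z', a⟩, ⟨g', hg'⟩, ⟨h', hh'⟩⟩ ⟨hm', hn', hc'⟩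
      have := hu ⟨z', g', h'⟩ ⟨hm', hn', congrArg Subtype.val hc'⟩
      cases this
      change p.cls ≫ FreeGroupoid.homMk g = a at hg'
      subst hg'
      rfl
  connected := inferInstance
  rowFinite p n :=
    Set.Finite.of_finite_image ((Δ.rowFinite p.base n).subset (by rintro _ ⟨q, hq, rfl⟩; exact hq))
      (UniversalOb.costar_proj_bijective p).1.injOn
  noSources p n := by
    obtain ⟨q, hq⟩ := Δ.noSources p.base n
    obtain ⟨q', rfl⟩ := (UniversalOb.costar_proj_bijective p).2 q
    exact ⟨q', hq⟩

/-- The universal covering map. -/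
def universalProj : universalCover Δ v ⟶ Δ where
  toFunctor := UniversalOb.proj Δ v
  deg_map _ := rfl

theorem isCovering_universalProj : IsCovering (universalProj Δ v) :=
  ⟨UniversalOb.star_proj_bijective, UniversalOb.costar_proj_bijective⟩

/-- The universal covering of `Δ` lifts along every covering of a `k`-graph to which `Δ` maps. -/
theorem exists_universalCover_lift {S B : KGraph.{u} k} (g : Δ ⟶ B) {β : S ⟶ B}
    (hβ : IsCovering β) :
    ∃ φ : universalCover Δ v ⟶ S, φ ≫ β = universalProj Δ v ≫ g := by
  obtain ⟨s, hs⟩ := hβ.surjective_obj (g.obj v)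
  -- Since the target is a groupoid, the fibre functor extends to the free groupoid; `o p` is then
  -- the chosen point `s` transported along `p.cls`.
  let F : FreeGroupoid Δ.Ob ⥤ Core (Type u) := FreeGroupoid.lift (g.toFunctor ⋙ hβ.fibre)
  let o (p : UniversalOb Δ v) : {s // β.obj s = g.obj p.base} := (F.map p.cls).iso.hom ⟨s, hs⟩
  have ho {p q : UniversalOb Δ v} (f : p ⟶ q) : o q = hβ.transport (g.map f.1) (o p) := by
    obtain ⟨y, b⟩ := q
    obtain ⟨(f : p.base ⟶ y), hf⟩ := f
    change p.cls ≫ FreeGroupoid.homMk f = b at hf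
    subst hf
    dsimp only [o]
    rw [Functor.map_comp, FreeGroupoid.lift_map_homMk]
    rfl
  obtain ⟨φ, hφ, -⟩ := exists_hom_of_obj (fun v => (hβ.star_bijective v).1)
    (universalProj Δ v ≫ g) (fun p => (o p).1) fun {p q} f => by
      rw [ho f]
      exact hβ.exists_transport _ _
  exact ⟨φ, hφ⟩

theorem isUniversalCovering_universalProj : IsUniversalCovering (universalProj Δ v) :=
  ⟨isCovering_universalProj Δ v, fun S β hβ => by
    simpa using exists_universalCover_lift Δ v (𝟙 Δ) hβ⟩

end UniversalCover

/-! ### Walks under morphisms and coverings. -/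

variable {S B : KGraph.{u} k}

/-- Identities are exactly the paths of degree zero, and degrees are preserved. This keeps reversed
edges proper when walks are mapped or lifted. -/
theorem isIdentity_onPath_iff (φ : S ⟶ B) (e : S.Path) :
    (Hom.onPath φ e).IsIdentity ↔ e.IsIdentity :=
  ⟨fun h => RepKGraph.isIdentity_of_deg e.hom
      ((φ.deg_map e.hom).symm.trans (RepKGraph.deg_of_isIdentity _ h)),
    fun h => RepKGraph.isIdentity_of_deg _
      ((φ.deg_map e.hom).trans (RepKGraph.deg_of_isIdentity e.hom h))⟩

theorem onEdge_comp {W : KGraph.{u} k} (φ : W ⟶ S) (ψ : S ⟶ B) :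
    Hom.onEdge (φ ≫ ψ) = Hom.onEdge ψ ∘ Hom.onEdge φ := by
  funext e
  cases e <;> rfl

theorem IsChain.map (φ : S ⟶ B) {u v : S.Ob} {p : List (Edge S)} (h : IsChain u p v) :
    IsChain (φ.obj u) (p.map (Hom.onEdge φ)) (φ.obj v) := by
  induction p generalizing u with
  | nil => exact congrArg φ.obj h
  | cons e p ih =>
    obtain ⟨he, rfl, hp⟩ := h
    cases e with
    | pos e => exact ⟨trivial, rfl, ih hp⟩
    | neg e => exact ⟨mt (isIdentity_onPath_iff φ e).1 he, rfl, ih hp⟩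

/-- Forward edges are lifted with prescribed source, reversed edges with prescribed range. -/
theorem IsCovering.exists_chain {φ : S ⟶ B} (hφ : IsCovering φ) {u : S.Ob} {w : B.Ob}
    {q : List (Edge B)} (h : IsChain (φ.obj u) q w) :
    ∃ p v, IsChain u p v ∧ p.map (Hom.onEdge φ) = q := by
  induction q generalizing u with
  | nil => exact ⟨[], u, rfl, rfl⟩
  | cons e q ih =>
    obtain ⟨he, hs, hq⟩ := h
    cases e with
    | pos e =>
      obtain ⟨t, f, rfl⟩ := exists_lift_left (fun v => (hφ.star_bijective v).2) hs.symm
      obtain ⟨p, v, hp, rfl⟩ := ih (u := t) hq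
      exact ⟨.pos ⟨u, t, f⟩ :: p, v, ⟨trivial, rfl, hp⟩, rfl⟩
    | neg e =>
      obtain ⟨t, f, rfl⟩ := exists_lift_right (fun v => (hφ.costar_bijective v).2) hs.symm
      obtain ⟨p, v, hp, rfl⟩ := ih (u := t) hq
      exact ⟨.neg ⟨t, u, f⟩ :: p, v, ⟨mt (isIdentity_onPath_iff φ _).2 he, rfl, hp⟩, rfl⟩

theorem IsCovering.walkImage_comp {W : KGraph.{u} k} {φ : W ⟶ S} (hφ : IsCovering φ) (ψ : S ⟶ B)
    (u : W.Ob) : walkImage (φ ≫ ψ) u = walkImage ψ (φ.obj u) := by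
  ext w
  constructor
  · rintro ⟨p, v, ⟨hp, hc⟩, rfl⟩
    exact ⟨p.map (Hom.onEdge φ), φ.obj v, ⟨by simpa using hp, hc.map φ⟩, by
      rw [List.map_map, onEdge_comp]⟩
  · rintro ⟨q, v, ⟨hq, hc⟩, rfl⟩
    obtain ⟨p, x, hp, rfl⟩ := hφ.exists_chain hc
    exact ⟨p, x, ⟨by simpa using hq, hp⟩, by rw [List.map_map, onEdge_comp]⟩

end KGraph

open KGraph

/-! ### Morphisms of representation `k`-graphs as coverings. -/

namespace RepKGraph

variable {Λ : KGraph.{u} k} {X Y Z : RepKGraph Λ}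

/-- `X.map` need not be a covering, but equal images have equal degrees, and only one path of each
degree ends in a given vertex. -/
theorem eq_of_onPath_eq_of_right_eq {e e' : X.graph.Path} (hr : e.right = e'.right)
    (he : KGraph.Hom.onPath X.map e = KGraph.Hom.onPath X.map e') : e = e' := by
  have hd := deg_eq_of_onPath_eq he
  obtain ⟨x, y, f⟩ := e
  obtain ⟨x', y', f'⟩ := e'
  obtain rfl : y = y' := hr
  have := (X.existsUnique_range y (X.graph.deg f')).unique
    (y₁ := (⟨x, f⟩ : Quiver.Costar y)) (y₂ := (⟨x', f'⟩ : Quiver.Costar y)) hd rfl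
  cases this
  rfl

/-- Chains starting in the same vertex and with the same image have the same end. -/
theorem end_eq_of_map_eq {v x y : X.graph.Ob} {p q : List (Edge X.graph)} (hp : IsChain v p x)
    (hq : IsChain v q y)
    (h : p.map (KGraph.Hom.onEdge X.map) = q.map (KGraph.Hom.onEdge X.map)) : x = y := by
  induction p generalizing v q with
  | nil =>
    obtain rfl : q = [] := by simpa using h.symm
    exact hp.symm.trans hq
  | cons e p ih =>
    obtain _ | ⟨e', q⟩ := q
    · simp at h
    obtain ⟨hee, hpq⟩ := List.cons.inj h
    obtain ⟨-, he, hp⟩ := hp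
    obtain ⟨-, he', hq⟩ := hq
    have : e = e' := by
      cases e <;> cases e' <;> simp only [KGraph.Hom.onEdge, Edge.pos.injEq, Edge.neg.injEq,
        reduceCtorEq] at hee
      · exact congrArg Edge.pos (eq_of_onPath_eq_of_left_eq (fun v => (X.bijective_source v).1)
          (he.trans he'.symm) hee)
      · exact congrArg Edge.neg (eq_of_onPath_eq_of_right_eq (he.trans he'.symm) hee)
    subst this
    exact ih hp hq hpq

/-- Every morphism of representation `k`-graphs is a covering. -/
theorem isCovering_hom (φ : X ⟶ Y) : IsCovering φ.hom := by
  refine ⟨fun v => ?_, fun v => ⟨?_, ?_⟩⟩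
  · have h := X.bijective_source v
    rw [← φ.comm] at h
    exact (Function.Bijective.of_comp_iff' (Y.bijective_source (φ.hom.obj v)) _).1 h
  · intro p q hpq
    refine (X.existsUnique_range v (X.graph.deg q.2)).unique ?_ rfl
    have := congrArg (fun p : Quiver.Costar (φ.hom.obj v) => Y.graph.deg p.2) hpq
    exact (φ.hom.deg_map p.2).symm.trans (this.trans (φ.hom.deg_map q.2))
  · intro q
    obtain ⟨p, hp, -⟩ := X.existsUnique_range v (Y.graph.deg q.2)
    exact ⟨p, (Y.existsUnique_range _ (Y.graph.deg q.2)).unique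
      ((φ.hom.deg_map p.2).trans hp) rfl⟩

theorem hom_ext_of_obj {φ ψ : X ⟶ Y} (h : ∀ x, φ.hom.obj x = ψ.hom.obj x) : φ = ψ :=
  Hom.ext (KGraph.hom_ext_of_obj (fun v => (Y.bijective_source v).1) h
    (φ.comm.trans ψ.comm.symm))

/-- As `φ` is a covering that is surjective on vertices, a path of `Y` lifts to `X` and can be
pushed to `Z` by `ψ`; the hypothesis makes the result independent of the choices. -/
theorem exists_factor (φ : X ⟶ Y) (ψ : X ⟶ Z)
    (h : ∀ x x', φ.hom.obj x = φ.hom.obj x' → ψ.hom.obj x = ψ.hom.obj x') :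
    ∃ θ : Y ⟶ Z, ∀ x, θ.hom.obj (φ.hom.obj x) = ψ.hom.obj x := by
  have hφ := isCovering_hom φ
  choose s hs using hφ.surjective_obj
  obtain ⟨θ, hθ, hobj⟩ := exists_hom_of_obj (fun v => (Z.bijective_source v).1) Y.map
    (fun y => ψ.hom.obj (s y)) fun {y y'} f => by
      obtain ⟨x, f', hf'⟩ := exists_lift_left (fun v => (hφ.star_bijective v).2)
        (e := ⟨y, y', f⟩) (hs y)
      have hx : φ.hom.obj x = y' := congrArg Quiver.Total.right hf'
      -- The lift ends in `x`, not necessarily in the chosen preimage `s y'`, but `ψ` does not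
      -- distinguish the two.
      rw [h (s y') x ((hs y').trans hx.symm)]
      refine ⟨ψ.hom.map f', ?_⟩
      rw [← hf', ← onPath_comp_hom, φ.comm, ← ψ.comm]
      rfl
  exact ⟨⟨θ, hθ⟩, fun x => (hobj _).trans (h _ _ (hs _))⟩

/-- Two representation `k`-graphs that are images of the same one are isomorphic if the fibres of
the two morphisms coincide. -/
theorem nonempty_iso (φ : X ⟶ Y) (ψ : X ⟶ Z)
    (h : ∀ x x', φ.hom.obj x = φ.hom.obj x' ↔ ψ.hom.obj x = ψ.hom.obj x') :
    Nonempty (Y ≅ Z) := by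
  obtain ⟨θ, hθ⟩ := exists_factor φ ψ fun x x' => (h x x').1
  obtain ⟨η, hη⟩ := exists_factor ψ φ fun x x' => (h x x').2
  -- Morphisms over `Λ` are determined on vertices, and all vertices come from `X`.
  refine ⟨⟨θ, η, hom_ext_of_obj fun y => ?_, hom_ext_of_obj fun z => ?_⟩⟩
  · obtain ⟨x, rfl⟩ := (isCovering_hom φ).surjective_obj y
    change η.hom.obj (θ.hom.obj _) = _
    rw [hθ, hη]
    rfl
  · obtain ⟨x, rfl⟩ := (isCovering_hom ψ).surjective_obj z
    change θ.hom.obj (η.hom.obj _) = _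
    rw [hη, hθ]
    rfl

/-! ### Quotients as images of morphisms. -/

/-- The projection onto a quotient. -/
noncomputable def quotientProj {r : Setoid X.graph.Ob} (h : IsAdmissible X r) :
    X ⟶ X.quotient r h where
  hom := { toFunctor := quotProj h, deg_map := fun _ => rfl }
  comm := hom_ext_of_onPath fun e =>
    congrArg (fun f => (⟨_, _, f⟩ : Λ.Path)) (quotMap_mk (h := h) e.hom)

/-- The fibres of a morphism of representation `k`-graphs form an admissible equivalence
relation. -/
theorem isAdmissible_ker (φ : X ⟶ Y) : IsAdmissible X (Setoid.ker φ.hom.obj) where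
  walkImage_eq u v huv := by
    have huv : φ.hom.obj u = φ.hom.obj v := huv
    rw [← φ.comm, (isCovering_hom φ).walkImage_comp, (isCovering_hom φ).walkImage_comp, huv]
  range_rel u v x y p q huv hp hq hpq := by
    have hq' := hq.2.map φ.hom
    rw [← show φ.hom.obj u = φ.hom.obj v from huv] at hq'
    -- Pushed to `Y`, the two walks start in the same vertex and have the same image in `Λ`.
    refine end_eq_of_map_eq (hp.2.map φ.hom) hq' ?_
    rwa [List.map_map, List.map_map, ← onEdge_comp, φ.comm]

theorem isIsoToQuotient_of_hom (φ : X ⟶ Y) : IsIsoToQuotient Y X :=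
  ⟨_, isAdmissible_ker φ, nonempty_iso φ (quotientProj _) fun _ _ =>
    ⟨fun h => Quotient.sound h, fun h => Quotient.exact h⟩⟩

theorem IsIsoToQuotient.zigzag (h : IsIsoToQuotient Y X) : Zigzag X Y := by
  obtain ⟨r, h, ⟨i⟩⟩ := h
  exact Zigzag.of_hom (quotientProj h ≫ i.inv)

/-! ### Morphisms out of a universal covering. -/

/-- The morphism from the total space of a covering. -/
def ofCoveringHom {Ω : KGraph.{u} k} (τ : Ω ⟶ X.graph) (hτ : IsCovering τ) :
    X.ofCovering τ hτ ⟶ X := ⟨τ, rfl⟩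

theorem nonempty_hom_of_zigzag {Ω : KGraph.{u} k} {τ : Ω ⟶ X.graph} (hτ : IsUniversalCovering τ)
    (h : Zigzag X Y) : Nonempty (X.ofCovering τ hτ.isCovering ⟶ Y) := by
  induction h with
  | refl => exact ⟨ofCoveringHom τ _⟩
  | @tail Y Z _ hYZ ih =>
    obtain ⟨m⟩ := ih
    obtain ⟨⟨ψ⟩⟩ | ⟨⟨ψ⟩⟩ := hYZ
    · exact ⟨m ≫ ψ⟩
    obtain ⟨v⟩ := Ω.connected.is_nonempty
    -- `m` starts at `Ω`, whose universality concerns only coverings of `X.graph`. So `m` is lifted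
    -- through `ψ` on `universalCover Ω v`, which covers `X.graph` by way of `Ω` and hence receives
    -- a morphism `σ` from `Ω`.
    obtain ⟨σ, hσ⟩ := hτ.exists_hom _ (universalProj Ω v ≫ τ)
      ((isCovering_universalProj Ω v).comp _ _ hτ.isCovering)
    obtain ⟨φ, hφ⟩ := exists_universalCover_lift Ω v m.hom (isCovering_hom ψ)
    have hm : m.hom ≫ Y.map = τ ≫ X.map := m.comm
    -- It is not needed that `σ` be a section of `universalProj Ω v`: the triangle is required only
    -- over `Λ`, where `hσ` suffices.
    have key : (σ ≫ φ) ≫ Z.map = τ ≫ X.map := by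
      rw [← ψ.comm, Category.assoc, reassoc_of% hφ]
      calc σ ≫ universalProj Ω v ≫ m.hom ≫ Y.map
          = (σ ≫ universalProj Ω v ≫ τ) ≫ X.map := by
            simp only [Category.assoc]
            exact congrArg (fun f => σ ≫ universalProj Ω v ≫ f) hm
        _ = τ ≫ X.map := by rw [hσ]
    exact ⟨⟨σ ≫ φ, key⟩⟩

end RepKGraph

end HigherRank

theorem theorem3p11 {k : ℕ} (hk : 0 < k) (Λ : HigherRank.KGraph.{u} k)
    (C : ConnectedComponents (HigherRank.RepKGraph Λ))
    (X : HigherRank.RepKGraph Λ) (hX : C.objectProperty X) :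
    (∃ (Ω : HigherRank.KGraph.{u} k) (τ : Ω ⟶ X.graph),
      HigherRank.KGraph.IsUniversalCovering τ) ∧
    ∀ (Ω : HigherRank.KGraph.{u} k) (τ : Ω ⟶ X.graph)
      (hτ : HigherRank.KGraph.IsUniversalCovering τ),
      (∃ hC : C.objectProperty (X.ofCovering τ hτ.isCovering),
        HigherRank.IsRepelling (⟨X.ofCovering τ hτ.isCovering, hC⟩ : C.Component)) ∧
      ∀ Y : HigherRank.RepKGraph Λ,
        C.objectProperty Y ↔
          HigherRank.RepKGraph.IsIsoToQuotient Y (X.ofCovering τ hτ.isCovering) := by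
  obtain ⟨v⟩ := X.graph.connected.is_nonempty
  refine ⟨⟨_, _, HigherRank.KGraph.isUniversalCovering_universalProj X.graph v⟩, fun Ω τ hτ => ?_⟩
  have hzig : Zigzag (X.ofCovering τ hτ.isCovering) X :=
    Zigzag.of_hom (HigherRank.RepKGraph.ofCoveringHom τ hτ.isCovering)
  have hom {Y : HigherRank.RepKGraph Λ} (hY : C.objectProperty Y) :
      Nonempty (X.ofCovering τ hτ.isCovering ⟶ Y) :=
    HigherRank.RepKGraph.nonempty_hom_of_zigzag hτ (Quotient.exact' (hX.trans hY.symm))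
  refine ⟨⟨(Quotient.sound' hzig).trans hX, fun Y => ?_⟩, fun Y => ⟨fun hY => ?_, fun hY => ?_⟩⟩
  · obtain ⟨m⟩ := hom Y.2
    exact ⟨⟨m⟩⟩
  · obtain ⟨m⟩ := hom hY
    exact HigherRank.RepKGraph.isIsoToQuotient_of_hom m
  · exact (Quotient.sound' (hY.zigzag.symm.trans hzig)).trans hX
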